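/- Write $\ell_p$ for the space of real sequences $(a_k)_{k\ge 1}$ with $\|a\|_{\ell_p}=(\sum_k|a_k|^p)^{1/p}<\infty$. There is a universal constant $c>0$ with the following property. Let $p\in[1,2)$, $q\in(p,\infty)$ and $r,s\in[1,\infty)$. Then for arbitrarily large $n\in\mathbb N$ there exist $x_1,\dots,x_n\in\ell_p$ such that for every $y_1,\dots,y_n\in\ell_q$ with $$\Big(\frac1{n^2}\sum_{i=1}^n\sum_{j=1}^n\|y_i-y_j\|_{\ell_q}^r\Big)^{1/r}=\Big(\frac1{n^2}\sum_{i=1}^n\sum_{j=1}^n\|x_i-x_j\|_{\ell_p}^s\Big)^{1/s}$$ there exist $i,j\in\{1,\dots,n\}$ with $$\|y_i-y_j\|_{\ell_q}\ \ge\ c\,\frac{(\log n)^{\frac1p-\frac1{\min\{q,2\}}}}{\sqrt{q+r}}\,\|x_i-x_j\|_{\ell_p}\qquad\text{and}\qquad \frac{(\log n)^{\frac1p-\frac1{\min\{q,2\}}}}{\sqrt{q+r}}\,\|x_i-x_j\|_{\ell_p}>0.$$ Moreover, $n=2^m$ for some $m$, and $x_1,\dots,x_n$ can be taken to be an enumeration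 of the vertices of the Hamming cube $\{0,1\}^m\subseteq\ell_p$ (the $\{0,1\}$-valued sequences supported on the first $m$ coordinates). Consequently, for no $p\in[1,2)$ is there a constant $K\in\mathbb R$ such that for every $n\in\mathbb N$ and all $x_1,\dots,x_n\in\ell_p$ there exist $y_1,\dots,y_n\in\ell_2$ with $\|y_i-y_j\|_{\ell_2}\le K\|x_i-x_j\|_{\ell_p}$ for all $i,j\in\{1,\dots,n\}$ and $\sum_{i,j=1}^n\|y_i-y_j\|_{\ell_2}^2=\sum_{i,j=1}^n\|x_i-x_j\|_{\ell_p}^2$. -/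

import Mathlib

/-- The real sequence space `ℓ_p` (over the index set `ℕ`), for a real exponent `p`. -/
abbrev Ell (p : ℝ) : Type := lp (fun _ : ℕ => ℝ) (ENNReal.ofReal p)

/-- The vertices of the `m`-dimensional Hamming cube `{0,1}^m`, as a subset of `ℓ_p`: the
`{0,1}`-valued sequences that vanish from the `m`-th coordinate on (coordinates counted from `0`). -/
def hammingCube (p : ℝ) (m : ℕ) : Set (Ell p) :=
  {x | (∀ k : ℕ, x k = 0 ∨ x k = 1) ∧ ∀ k : ℕ, m ≤ k → x k = 0}

/-- The normalized average distance with exponent `s` of the points `x_1, …, x_n` of `ℓ_p`,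
`((1 / n²) ∑_{i,j} ‖x_i - x_j‖ ^ s) ^ (1 / s)`. -/
noncomputable def avgDist (p s : ℝ) {n : ℕ} (x : Fin n → Ell p) : ℝ :=
  ((1 / (n : ℝ) ^ 2) * ∑ i, ∑ j, ‖x i - x j‖ ^ s) ^ (1 / s)

/-! In the cube `{0,1}^m` in `ℓ_p` edges have length 1, while the average distance is at least
`m^(1/p)/2`, since two random vertices differ in `m/2` coordinates on average. In `ℓ_q`, a map of
the cube that stretches every edge by at most `L` has average distance at most `2√(q+r)
m^(1/min(q,2)) L` (`Ell.cube_average_le`). If the two averages agree, then `L` must be at least of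
order `m^(1/p - 1/min(q,2)) / √(q+r)`, and `log n = m log 2 ≤ m`.

The upper bound expresses the smoothness of `ℓ_q`. An even-power two-point inequality for scalars is
lifted coordinatewise to `ℓ_q` (`Ell.two_point_le`), then tensorized over the cube by induction on
`m` (`cube_moment_le`). The constant `4k` for the moment `2k`, with `k` of order `q+r`, produces the
factor `√(q+r)`. -/

/-! ### Two-point inequalities for real numbers -/

/-- A two-point Khintchine-type inequality for even powers. -/
theorem add_pow_add_sub_pow_le (a b : ℝ) (k : ℕ) :
    ((a + b) ^ (2 * k) + (a - b) ^ (2 * k)) / 2 ≤ (a ^ 2 + 4 * k * b ^ 2) ^ k := by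
  -- With `S` the half-sum and `T` equal to `ab` times the half-difference, multiplying by `(a ±
  -- b)²` gives a linear recursion in `(S, T)`. The bound `T ≤ 2n b² S` closes it: `S` grows by at
  -- most `a² + (4n+1)b²`, and `4n+1 ≤ 4k` while `n < k`.
  have key : ∀ n : ℕ,
      0 ≤ a * b * (((a + b) ^ (2 * n) - (a - b) ^ (2 * n)) / 2) ∧
      a * b * (((a + b) ^ (2 * n) - (a - b) ^ (2 * n)) / 2) ≤
        2 * n * b ^ 2 * (((a + b) ^ (2 * n) + (a - b) ^ (2 * n)) / 2) ∧
      (n ≤ k → ((a + b) ^ (2 * n) + (a - b) ^ (2 * n)) / 2 ≤ (a ^ 2 + 4 * k * b ^ 2) ^ n) := by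
    intro n
    induction n with
    | zero => simp
    | succ n ih =>
      obtain ⟨h0, h1, h2⟩ := ih
      have hS : 0 ≤ ((a + b) ^ (2 * n) + (a - b) ^ (2 * n)) / 2 := by
        have := (even_two_mul n).pow_nonneg (a + b)
        have := (even_two_mul n).pow_nonneg (a - b)
        linarith
      have eS : ((a + b) ^ (2 * (n + 1)) + (a - b) ^ (2 * (n + 1))) / 2 =
          (a ^ 2 + b ^ 2) * (((a + b) ^ (2 * n) + (a - b) ^ (2 * n)) / 2) +
          2 * (a * b * (((a + b) ^ (2 * n) - (a - b) ^ (2 * n)) / 2)) := by ring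
      have eT : a * b * (((a + b) ^ (2 * (n + 1)) - (a - b) ^ (2 * (n + 1))) / 2) =
          (a ^ 2 + b ^ 2) * (a * b * (((a + b) ^ (2 * n) - (a - b) ^ (2 * n)) / 2)) +
          2 * (a ^ 2 * b ^ 2) * (((a + b) ^ (2 * n) + (a - b) ^ (2 * n)) / 2) := by ring
      rw [eS, eT]
      generalize ((a + b) ^ (2 * n) + (a - b) ^ (2 * n)) / 2 = S at *
      generalize a * b * (((a + b) ^ (2 * n) - (a - b) ^ (2 * n)) / 2) = T at *
      refine ⟨by positivity, ?_, fun hn => ?_⟩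
      · have e1 := mul_le_mul_of_nonneg_left h1 (by positivity : 0 ≤ a ^ 2 + b ^ 2)
        have e2 : 0 ≤ 2 * b ^ 2 * b ^ 2 * S := by positivity
        have e3 : 0 ≤ 2 * ((n : ℝ) + 1) * b ^ 2 * (2 * T) := by positivity
        push_cast
        linarith
      · have hn' : (n : ℝ) + 1 ≤ k := by exact_mod_cast hn
        have e1 : 0 ≤ (4 * k - (4 * n + 1)) * b ^ 2 * S :=
          mul_nonneg (mul_nonneg (by linarith) (sq_nonneg b)) hS
        calc (a ^ 2 + b ^ 2) * S + 2 * T ≤ (a ^ 2 + 4 * k * b ^ 2) * S := by linarith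
          _ ≤ (a ^ 2 + 4 * k * b ^ 2) * (a ^ 2 + 4 * k * b ^ 2) ^ n :=
              mul_le_mul_of_nonneg_left (h2 (by omega)) (by positivity)
          _ = _ := by ring
  exact (key k).2.2 le_rfl

/-- Minkowski's inequality for the normalized `L_τ` norm on two points. -/
theorem rpow_mean_two_add_le {τ : ℝ} (hτ : 1 ≤ τ) {u v u' v' : ℝ}
    (hu : 0 ≤ u) (hv : 0 ≤ v) (hu' : 0 ≤ u') (hv' : 0 ≤ v') :
    (((u + u') ^ τ + (v + v') ^ τ) / 2) ^ (1 / τ) ≤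
      ((u ^ τ + v ^ τ) / 2) ^ (1 / τ) + ((u' ^ τ + v' ^ τ) / 2) ^ (1 / τ) := by
  have h := Real.Lp_add_le_of_nonneg (s := (Finset.univ : Finset (Fin 2)))
    (f := ![u, v]) (g := ![u', v']) hτ
    (by intro i _; fin_cases i <;> simpa) (by intro i _; fin_cases i <;> simpa)
  simp only [Fin.sum_univ_two, Matrix.cons_val_zero, Matrix.cons_val_one] at h
  rw [Real.div_rpow (by positivity) (by norm_num), Real.div_rpow (by positivity) (by norm_num),
    Real.div_rpow (by positivity) (by norm_num), ← add_div]
  exact div_le_div_of_nonneg_right h (by positivity)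

theorem rpow_mean_two_sum_le {ι : Type*} {τ : ℝ} (hτ : 1 ≤ τ) (s : Finset ι) {u v : ι → ℝ}
    (hu : ∀ i, 0 ≤ u i) (hv : ∀ i, 0 ≤ v i) :
    (((∑ i ∈ s, u i) ^ τ + (∑ i ∈ s, v i) ^ τ) / 2) ^ (1 / τ) ≤
      ∑ i ∈ s, ((u i ^ τ + v i ^ τ) / 2) ^ (1 / τ) := by
  classical
  induction s using Finset.induction_on with
  | empty =>
    have : τ ≠ 0 := by linarith
    simp [Real.zero_rpow this, Real.zero_rpow (inv_ne_zero this)]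
  | insert i s hi ih =>
    rw [Finset.sum_insert hi, Finset.sum_insert hi, Finset.sum_insert hi]
    exact (rpow_mean_two_add_le hτ (hu i) (hv i) (Finset.sum_nonneg fun j _ => hu j)
      (Finset.sum_nonneg fun j _ => hv j)).trans (by gcongr)

/-- Minkowski against a constant function; it carries the error accumulated in lower dimensions
through the induction on the cube. -/
theorem mean_two_add_const_rpow_le {τ : ℝ} (hτ : 1 ≤ τ) {u v c : ℝ}
    (hu : 0 ≤ u) (hv : 0 ≤ v) (hc : 0 ≤ c) :
    ((u + c) ^ τ + (v + c) ^ τ) / 2 ≤ (((u ^ τ + v ^ τ) / 2) ^ (1 / τ) + c) ^ τ := by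
  have h := rpow_mean_two_add_le hτ hu hv hc hc
  have hτ0 : τ ≠ 0 := by linarith
  rw [add_self_div_two (c ^ τ), one_div, Real.rpow_rpow_inv hc hτ0, ← one_div] at h
  have h2 := Real.rpow_le_rpow (by positivity) h (by linarith : 0 ≤ τ)
  rwa [← Real.rpow_mul (by positivity), one_div_mul_cancel hτ0, Real.rpow_one] at h2

/-! ### Moments on the discrete cube -/

theorem sum_cube_succ {M : Type*} [AddCommMonoid M] {m : ℕ} (g : (Fin (m + 1) → Bool) → M) :
    ∑ x, g x = ∑ x, g (Fin.cons true x) + ∑ x, g (Fin.cons false x) := by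
  rw [← (Fin.consEquiv fun _ : Fin (m + 1) => Bool).sum_comp, Fintype.sum_prod_type,
    Fintype.sum_bool]
  rfl

/-- The moment inequality on the discrete cube for Lipschitz functions with values in a space
that satisfies a two-point smoothness inequality. -/
theorem cube_moment_le {E : Type*} [NormedAddCommGroup E] [NormedSpace ℝ E] {α t K : ℝ}
    (hα : 0 < α) (hαt : α ≤ t) (hK : 0 ≤ K)
    (H : ∀ a b : E, (‖a + b‖ ^ t + ‖a - b‖ ^ t) / 2 ≤ (‖a‖ ^ α + K * ‖b‖ ^ α) ^ (t / α))
    {L : ℝ} (hL : 0 ≤ L) (m : ℕ) (f : (Fin m → Bool) → E)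
    (hf : ∀ x i, ‖f x - f (Function.update x i (!x i))‖ ≤ L) :
    ((2 : ℝ) ^ m)⁻¹ * ∑ x, ‖f x‖ ^ t ≤
      (‖((2 : ℝ) ^ m)⁻¹ • ∑ x, f x‖ ^ α + m * (K * (L / 2) ^ α)) ^ (t / α) := by
  have hτ : 1 ≤ t / α := (one_le_div hα).2 hαt
  have pw : ∀ x : ℝ, 0 ≤ x → (x ^ α) ^ (t / α) = x ^ t := fun x hx => by
    rw [← Real.rpow_mul hx, mul_div_cancel₀ _ hα.ne']
  induction m with
  | zero => simp [pw]
  | succ m ih =>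
    have hedge : ∀ b : Bool, ∀ x i, ‖f (Fin.cons b x) -
        f (Fin.cons b (Function.update x i (!x i)))‖ ≤ L := by
      intro b x i
      have := hf (Fin.cons b x) i.succ
      rwa [Fin.cons_succ, ← Fin.cons_update] at this
    have h1 := ih (fun x => f (Fin.cons true x)) (hedge true)
    have h0 := ih (fun x => f (Fin.cons false x)) (hedge false)
    -- `A` and `B` are the means over two opposite facets. Edges in direction 0 match the facets, so
    -- `‖A - B‖ ≤ L`; the two-point inequality is applied to their half-sum and half-difference.
    set A := ((2 : ℝ) ^ m)⁻¹ • ∑ x, f (Fin.cons true x) with hA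
    set B := ((2 : ℝ) ^ m)⁻¹ • ∑ x, f (Fin.cons false x) with hB
    have hAB : ‖A - B‖ ≤ L := by
      rw [hA, hB, ← smul_sub, ← Finset.sum_sub_distrib, norm_smul, Real.norm_of_nonneg
        (by positivity), inv_mul_le_iff₀ (by positivity)]
      refine (norm_sum_le _ _).trans ((Finset.sum_le_card_nsmul _ _ L fun x _ => ?_).trans ?_)
      · have := hf (Fin.cons true x) 0
        simpa using this
      · simp
    have e1 : ((2 : ℝ) ^ (m + 1))⁻¹ • ∑ x, f x = (2⁻¹ : ℝ) • (A + B) := by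
      rw [sum_cube_succ, hA, hB, ← smul_add, smul_smul, pow_succ', mul_inv]
    have e2 : ((2 : ℝ) ^ (m + 1))⁻¹ * ∑ x, ‖f x‖ ^ t =
        (((2 : ℝ) ^ m)⁻¹ * ∑ x, ‖f (Fin.cons true x)‖ ^ t +
          ((2 : ℝ) ^ m)⁻¹ * ∑ x, ‖f (Fin.cons false x)‖ ^ t) / 2 := by
      rw [sum_cube_succ, pow_succ', mul_inv]; ring
    rw [e1, e2]
    set a := (2⁻¹ : ℝ) • (A + B) with ha
    set b := (2⁻¹ : ℝ) • (A - B) with hb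
    have hab : A = a + b := by rw [ha, hb]; module
    have hab' : B = a - b := by rw [ha, hb]; module
    have hbL : ‖b‖ ≤ L / 2 := by
      rw [hb, norm_smul]; norm_num; linarith
    have hc : 0 ≤ m * (K * (L / 2) ^ α) := by positivity
    calc _ ≤ ((‖A‖ ^ α + m * (K * (L / 2) ^ α)) ^ (t / α) +
          (‖B‖ ^ α + m * (K * (L / 2) ^ α)) ^ (t / α)) / 2 := by linarith
      _ ≤ ((((‖A‖ ^ α) ^ (t / α) + (‖B‖ ^ α) ^ (t / α)) / 2) ^ (1 / (t / α)) +
          m * (K * (L / 2) ^ α)) ^ (t / α) :=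
          mean_two_add_const_rpow_le hτ (by positivity) (by positivity) hc
      _ ≤ ((‖a‖ ^ α + K * ‖b‖ ^ α) + m * (K * (L / 2) ^ α)) ^ (t / α) := by
          rw [pw _ (norm_nonneg _), pw _ (norm_nonneg _), hab, hab']
          gcongr
          rw [one_div, Real.rpow_inv_le_iff_of_pos (by positivity) (by positivity)
            (by linarith)]
          exact H a b
      _ ≤ _ := by
          have : ‖b‖ ^ α ≤ (L / 2) ^ α := Real.rpow_le_rpow (norm_nonneg _) hbL hα.le
          have := mul_le_mul_of_nonneg_left this hK
          refine Real.rpow_le_rpow (by positivity) ?_ (by linarith)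
          push_cast
          linarith

/-! ### Smoothness of `ℓ_q` and average distances -/

/-- For `q ≤ 2` this is subadditivity of `u ↦ u^(q/2)`; for `q ≥ 2` it is Minkowski in `ℓ_{q/2}`. -/
theorem sum_sq_add_mul_sq_rpow_le {ι : Type*} {q C A B : ℝ} (hq : 1 ≤ q) (hC : 0 ≤ C)
    (hA : 0 ≤ A) (hB : 0 ≤ B) (s : Finset ι) (a b : ι → ℝ)
    (ha : ∑ i ∈ s, |a i| ^ q ≤ A ^ q) (hb : ∑ i ∈ s, |b i| ^ q ≤ B ^ q) :
    ∑ i ∈ s, (a i ^ 2 + C * b i ^ 2) ^ (q / 2) ≤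
      (A ^ min q 2 + C ^ (min q 2 / 2) * B ^ min q 2) ^ (q / min q 2) := by
  have hsq : ∀ x : ℝ, (x ^ 2) ^ (q / 2) = |x| ^ q := fun x => by
    rw [← sq_abs, ← Real.rpow_natCast, ← Real.rpow_mul (abs_nonneg x)]
    congr 1; push_cast; ring
  rcases le_total q 2 with h | h
  · rw [min_eq_left h, div_self (by linarith), Real.rpow_one]
    calc _ ≤ ∑ i ∈ s, (|a i| ^ q + C ^ (q / 2) * |b i| ^ q) := by
          refine Finset.sum_le_sum fun i _ => ?_
          rw [← hsq, ← hsq, ← Real.mul_rpow hC (sq_nonneg _)]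
          exact Real.rpow_add_le_add_rpow (by positivity) (by positivity) (by linarith)
            (by linarith)
      _ ≤ _ := by
          rw [Finset.sum_add_distrib, ← Finset.mul_sum]
          gcongr
  · rw [min_eq_right h, div_self two_ne_zero, Real.rpow_one]
    have hq2 : 0 < q / 2 := by linarith
    have hM := Real.Lp_add_le_of_nonneg (s := s) (f := fun i => a i ^ 2)
      (g := fun i => C * b i ^ 2) (p := q / 2) (by linarith) (fun i _ => by positivity)
      (fun i _ => by positivity)
    simp only [Real.mul_rpow hC (sq_nonneg _), hsq, ← Finset.mul_sum] at hM
    have e : ∀ x : ℝ, 0 ≤ x → (x ^ q) ^ (1 / (q / 2)) = x ^ (2 : ℝ) := fun x hx => by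
      rw [← Real.rpow_mul hx]; congr 1; field_simp
    rw [← Real.rpow_inv_le_iff_of_pos (Finset.sum_nonneg fun i _ => by positivity)
      (by positivity) hq2, ← one_div]
    refine hM.trans (add_le_add ?_ ?_)
    · rw [← e A hA]
      exact Real.rpow_le_rpow (Finset.sum_nonneg fun i _ => by positivity) ha (by positivity)
    · rw [Real.mul_rpow (by positivity) (Finset.sum_nonneg fun i _ => by positivity),
        ← Real.rpow_mul hC, mul_one_div_cancel hq2.ne', Real.rpow_one, ← e B hB]
      refine mul_le_mul_of_nonneg_left ?_ hC
      exact Real.rpow_le_rpow (Finset.sum_nonneg fun i _ => by positivity) hb (by positivity)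

/-- The two-point smoothness inequality in `ℓ_q`, for a high even moment. -/
theorem Ell.two_point_le {q : ℝ} [Fact (1 ≤ ENNReal.ofReal q)] (hq : 1 ≤ q) (k : ℕ)
    (hk : q ≤ 2 * k) (a b : Ell q) :
    (‖a + b‖ ^ (2 * k : ℝ) + ‖a - b‖ ^ (2 * k : ℝ)) / 2 ≤
      (‖a‖ ^ min q 2 + (4 * k : ℝ) ^ (min q 2 / 2) * ‖b‖ ^ min q 2) ^ (2 * k / min q 2) := by
  have hq0 : 0 < q := by linarith
  have hqr : (ENNReal.ofReal q).toReal = q := ENNReal.toReal_ofReal hq0.le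
  have hpos : 0 < (ENNReal.ofReal q).toReal := by rw [hqr]; exact hq0
  have hα : 0 < min q 2 := lt_min hq0 two_pos
  set τ := 2 * k / q with hτdef
  have hτ : 1 ≤ τ := (one_le_div hq0).2 hk
  have hτ0 : 0 < τ := by linarith
  have pw : ∀ x : ℝ, 0 ≤ x → (x ^ q) ^ τ = x ^ (2 * k : ℝ) := fun x hx => by
    rw [← Real.rpow_mul hx, hτdef, mul_div_cancel₀ _ hq0.ne']
  have hs : ∀ c : Ell q, HasSum (fun i => |c i| ^ q) (‖c‖ ^ q) := fun c => by
    simpa only [hqr, Real.norm_eq_abs] using lp.hasSum_norm hpos c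
  have hfin : ∀ c : Ell q, ∀ s : Finset ℕ, ∑ i ∈ s, |c i| ^ q ≤ ‖c‖ ^ q := fun c s =>
    sum_le_hasSum s (fun i _ => by positivity) (hs c)
  set D := ‖a‖ ^ min q 2 + (4 * k : ℝ) ^ (min q 2 / 2) * ‖b‖ ^ min q 2
  have hD : 0 ≤ D := by positivity
  have hpt : ∀ i, ((((|(a + b) i| ^ q) ^ τ + (|(a - b) i| ^ q) ^ τ) / 2) ^ (1 / τ)) ≤
      (a i ^ 2 + 4 * k * b i ^ 2) ^ (q / 2) := fun i => by
    have h := add_pow_add_sub_pow_le (a i) (b i) k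
    have e : ∀ x : ℝ, (|x| ^ q) ^ τ = x ^ (2 * k) := fun x => by
      rw [pw _ (abs_nonneg x), ← (even_two_mul k).pow_abs, ← Real.rpow_natCast]
      push_cast; rfl
    rw [lp.coeFn_add, lp.coeFn_sub, Pi.add_apply, Pi.sub_apply, e, e]
    have h0 : 0 ≤ ((a i + b i) ^ (2 * k) + (a i - b i) ^ (2 * k)) / 2 := by
      have := (even_two_mul k).pow_nonneg (a i + b i)
      have := (even_two_mul k).pow_nonneg (a i - b i)
      linarith
    refine (Real.rpow_le_rpow h0 h (by positivity)).trans_eq ?_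
    have hk0 : (k : ℝ) ≠ 0 := by
      rintro h; rw [h] at hk; linarith
    rw [← Real.rpow_natCast, ← Real.rpow_mul (by positivity), hτdef]
    congr 1
    field_simp
  -- Minkowski is applied to finite sets of coordinates, and the bound passes to the limit.
  have hlim : Filter.Tendsto (fun s : Finset ℕ =>
      (((∑ i ∈ s, |(a + b) i| ^ q) ^ τ + (∑ i ∈ s, |(a - b) i| ^ q) ^ τ) / 2) ^ (1 / τ))
      Filter.atTop (nhds ((((‖a + b‖ ^ q) ^ τ + (‖a - b‖ ^ q) ^ τ) / 2) ^ (1 / τ))) :=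
    ((((hs (a + b)).rpow_const (Or.inr hτ0.le)).add
      ((hs (a - b)).rpow_const (Or.inr hτ0.le))).div_const 2).rpow_const
        (Or.inr (by positivity))
  have hle := le_of_tendsto' hlim fun s =>
    (rpow_mean_two_sum_le hτ s (fun i => by positivity) (fun i => by positivity)).trans <|
      (Finset.sum_le_sum fun i _ => hpt i).trans <|
        sum_sq_add_mul_sq_rpow_le hq (by positivity) (norm_nonneg a) (norm_nonneg b) s a b
          (hfin a s) (hfin b s)
  rw [pw _ (norm_nonneg _), pw _ (norm_nonneg _), one_div,
    Real.rpow_inv_le_iff_of_pos (by positivity) (by positivity) hτ0,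
    ← Real.rpow_mul hD] at hle
  refine hle.trans_eq ?_
  congr 1
  rw [hτdef]
  field_simp

/-- Centring `f` at its mean `M` leaves only the edge term in the moment bound. Convexity passes
from `f x - M` to differences, and Jensen from the exponent `2k` down to `r`. -/
theorem Ell.cube_average_le {q r L : ℝ} [Fact (1 ≤ ENNReal.ofReal q)] (hq : 1 ≤ q) (hr : 1 ≤ r)
    (hL : 0 ≤ L) (m : ℕ) (f : (Fin m → Bool) → Ell q)
    (hf : ∀ x i, ‖f x - f (Function.update x i (!x i))‖ ≤ L) :
    (1 / ((2 : ℝ) ^ m) ^ 2 * ∑ x, ∑ y, ‖f x - f y‖ ^ r) ^ (1 / r) ≤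
      2 * √(q + r) * (m : ℝ) ^ (1 / min q 2) * L := by
  have hα : 0 < min q 2 := lt_min (by linarith) two_pos
  obtain ⟨k, hkq, hkr, hk⟩ : ∃ k : ℕ, q ≤ 2 * k ∧ r ≤ 2 * k ∧ 4 * (k : ℝ) ≤ 4 * (q + r) := by
    -- Rounding up costs less than 4 in `4k`, which is absorbed because `q + r ≥ 2`.
    refine ⟨⌈max q r / 2⌉₊, ?_, ?_, ?_⟩
    · linarith [Nat.le_ceil (max q r / 2), le_max_left q r]
    · linarith [Nat.le_ceil (max q r / 2), le_max_right q r]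
    · have := Nat.ceil_lt_add_one (a := max q r / 2)
        (by linarith [le_max_left q r])
      have : max q r ≤ q + r := max_le (by linarith) (by linarith)
      linarith
  set t : ℝ := 2 * k with ht
  have ht1 : 1 ≤ t := hq.trans hkq
  have ht0 : 0 < t := by linarith
  set c : ℝ := m * ((4 * k : ℝ) ^ (min q 2 / 2) * (L / 2) ^ min q 2) with hc
  have hc0 : 0 ≤ c := by positivity
  set M := ((2 : ℝ) ^ m)⁻¹ • ∑ x, f x with hM
  have hcard : (Fintype.card (Fin m → Bool) : ℝ) = 2 ^ m := by simp
  have hmom : ((2 : ℝ) ^ m)⁻¹ * ∑ x, ‖f x - M‖ ^ t ≤ c ^ (t / min q 2) := by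
    have h := cube_moment_le hα ((min_le_left q 2).trans hkq) (by positivity)
      (Ell.two_point_le hq k hkq) hL m (fun x => f x - M) (by simpa using hf)
    have h0 : ((2 : ℝ) ^ m)⁻¹ • ∑ x, (f x - M) = 0 := by
      rw [Finset.sum_sub_distrib, smul_sub, ← hM, Finset.sum_const, Finset.card_univ,
        ← Nat.cast_smul_eq_nsmul ℝ, hcard, inv_smul_smul₀ (by positivity), sub_self]
    rwa [h0, norm_zero, Real.zero_rpow hα.ne', zero_add] at h
  have hpair : ∀ x y, ‖f x - f y‖ ^ t ≤ 2 ^ t / 2 * (‖f x - M‖ ^ t + ‖f y - M‖ ^ t) := by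
    intro x y
    have h1 : ‖f x - f y‖ ≤ 1 / 2 * (2 * ‖f x - M‖) + 1 / 2 * (2 * ‖f y - M‖) := by
      have := norm_sub_le_norm_sub_add_norm_sub (f x) M (f y)
      rw [norm_sub_rev M] at this
      linarith
    refine (Real.rpow_le_rpow (norm_nonneg _) h1 ht0.le).trans ?_
    refine ((convexOn_rpow ht1).2 (Set.mem_Ici.2 (by positivity : 0 ≤ 2 * ‖f x - M‖))
      (Set.mem_Ici.2 (by positivity : 0 ≤ 2 * ‖f y - M‖)) (by norm_num : (0 : ℝ) ≤ 1 / 2)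
      (by norm_num : (0 : ℝ) ≤ 1 / 2) (by norm_num)).trans_eq ?_
    simp only [smul_eq_mul]
    rw [Real.mul_rpow two_pos.le (norm_nonneg _), Real.mul_rpow two_pos.le (norm_nonneg _)]
    ring
  have havg : 1 / ((2 : ℝ) ^ m) ^ 2 * ∑ x, ∑ y, ‖f x - f y‖ ^ t ≤ 2 ^ t * c ^ (t / min q 2) := by
    calc _ ≤ 1 / ((2 : ℝ) ^ m) ^ 2 *
          ∑ x, ∑ y, 2 ^ t / 2 * (‖f x - M‖ ^ t + ‖f y - M‖ ^ t) := by
          gcongr with x _ y _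
          exact hpair x y
      _ = 2 ^ t * (((2 : ℝ) ^ m)⁻¹ * ∑ x, ‖f x - M‖ ^ t) := by
          simp only [← Finset.mul_sum, Finset.sum_add_distrib, Finset.sum_const,
            Finset.card_univ, nsmul_eq_mul, hcard]
          field_simp
          ring
      _ ≤ _ := by gcongr
  have hjensen : (1 / ((2 : ℝ) ^ m) ^ 2 * ∑ x, ∑ y, ‖f x - f y‖ ^ r) ^ (t / r) ≤
      1 / ((2 : ℝ) ^ m) ^ 2 * ∑ x, ∑ y, ‖f x - f y‖ ^ t := by
    have h := Real.rpow_arith_mean_le_arith_mean_rpow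
      (Finset.univ : Finset ((Fin m → Bool) × (Fin m → Bool)))
      (fun _ => 1 / ((2 : ℝ) ^ m) ^ 2) (fun z => ‖f z.1 - f z.2‖ ^ r)
      (fun _ _ => by positivity)
      (by simp only [Finset.sum_const, Finset.card_univ, Fintype.card_prod, nsmul_eq_mul,
            Nat.cast_mul, hcard]; field_simp)
      (fun _ _ => by positivity) ((one_le_div (by linarith)).2 hkr)
    have e : ∀ z : ℝ, 0 ≤ z → (z ^ r) ^ (t / r) = z ^ t := fun z hz => by
      rw [← Real.rpow_mul hz, mul_div_cancel₀ _ (by linarith)]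
    simpa only [← Finset.mul_sum, Fintype.sum_prod_type, e _ (norm_nonneg _)] using h
  have hX : 0 ≤ 1 / ((2 : ℝ) ^ m) ^ 2 * ∑ x, ∑ y, ‖f x - f y‖ ^ r := by positivity
  calc _ = ((1 / ((2 : ℝ) ^ m) ^ 2 * ∑ x, ∑ y, ‖f x - f y‖ ^ r) ^ (t / r)) ^ (1 / t) := by
        rw [← Real.rpow_mul hX]
        congr 1
        field_simp
    _ ≤ (2 ^ t * c ^ (t / min q 2)) ^ (1 / t) :=
        Real.rpow_le_rpow (by positivity) (hjensen.trans havg) (by positivity)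
    _ = 2 * c ^ (1 / min q 2) := by
        rw [Real.mul_rpow (by positivity) (by positivity), ← Real.rpow_mul two_pos.le,
          ← Real.rpow_mul hc0, mul_one_div_cancel ht0.ne', Real.rpow_one]
        congr 2
        field_simp
    _ = (m : ℝ) ^ (1 / min q 2) * √(4 * k) * L := by
        rw [hc, Real.mul_rpow (by positivity) (by positivity),
          Real.mul_rpow (by positivity) (by positivity), ← Real.rpow_mul (by positivity),
          ← Real.rpow_mul (by positivity), mul_one_div_cancel hα.ne', Real.rpow_one,
          Real.sqrt_eq_rpow]
        have : min q 2 / 2 * (1 / min q 2) = 1 / 2 := by field_simp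
        rw [this]
        ring
    _ ≤ (m : ℝ) ^ (1 / min q 2) * (2 * √(q + r)) * L := by
        gcongr
        refine (Real.sqrt_le_sqrt hk).trans_eq ?_
        rw [Real.sqrt_mul (by norm_num), show (4 : ℝ) = 2 ^ 2 by norm_num,
          Real.sqrt_sq (by norm_num)]
    _ = _ := by ring

/-! ### Distances in the Hamming cube -/

/-- The vertex of the Hamming cube in `ℓ_p` with given coordinates. -/
noncomputable def cubeVertex (p : ℝ) {m : ℕ} (v : Fin m → Bool) : Ell p :=
  ⟨fun k => if h : k < m then (if v ⟨k, h⟩ then 1 else 0) else 0, by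
    -- Finite support gives membership for exponent 0, hence for every exponent.
    refine (memℓp_zero ((Set.finite_lt_nat m).subset fun k hk => ?_)).of_exponent_ge zero_le
    by_contra h
    exact hk (dif_neg h)⟩

theorem cubeVertex_apply (p : ℝ) {m : ℕ} (v : Fin m → Bool) (k : ℕ) :
    cubeVertex p v k = if h : k < m then (if v ⟨k, h⟩ then 1 else 0) else 0 := rfl

theorem cubeVertex_injective (p : ℝ) (m : ℕ) :
    Function.Injective (cubeVertex p : (Fin m → Bool) → Ell p) := by
  intro v w h
  ext i
  have := congrArg (fun x : Ell p => x i) h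
  simp only [cubeVertex_apply, i.2, dif_pos, Fin.eta] at this
  cases hv : v i <;> cases hw : w i <;> simp_all

theorem range_cubeVertex (p : ℝ) (m : ℕ) :
    Set.range (cubeVertex p : (Fin m → Bool) → Ell p) = hammingCube p m := by
  ext x
  constructor
  · rintro ⟨v, rfl⟩
    refine ⟨fun k => ?_, fun k hk => ?_⟩
    · rw [cubeVertex_apply]
      split_ifs <;> simp
    · rw [cubeVertex_apply, dif_neg (by omega)]
  · rintro ⟨h1, h2⟩
    classical
    refine ⟨fun i => decide (x i = 1), ?_⟩
    ext k
    rw [cubeVertex_apply]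
    split_ifs with h h'
    · exact (of_decide_eq_true h').symm
    · rcases h1 k with h0 | h0
      · exact h0.symm
      · simp [h0] at h'
    · exact (h2 k (by omega)).symm

theorem norm_cubeVertex_sub {p : ℝ} (hp : 0 < p) {m : ℕ} (v w : Fin m → Bool) :
    ‖cubeVertex p v - cubeVertex p w‖ = (hammingDist v w : ℝ) ^ (1 / p) := by
  have hpr : (ENNReal.ofReal p).toReal = p := ENNReal.toReal_ofReal hp.le
  rw [lp.norm_eq_tsum_rpow (by rwa [hpr]), hpr]
  congr 1
  have hz : ∀ k ∉ Finset.range m, ‖(cubeVertex p v - cubeVertex p w) k‖ ^ p = 0 := by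
    intro k hk
    rw [Finset.mem_range] at hk
    rw [lp.coeFn_sub, Pi.sub_apply, cubeVertex_apply, cubeVertex_apply, dif_neg hk, dif_neg hk,
      sub_zero, norm_zero, Real.zero_rpow hp.ne']
  rw [tsum_eq_sum hz, Finset.sum_range, hammingDist, Finset.card_filter, Nat.cast_sum]
  refine Finset.sum_congr rfl fun i _ => ?_
  rw [lp.coeFn_sub, Pi.sub_apply, cubeVertex_apply, cubeVertex_apply, dif_pos i.2, dif_pos i.2]
  cases v i <;> cases w i <;> simp [Real.zero_rpow hp.ne']

/-- Pair each `w` with its complement: their distances from `v` add up to `m`. -/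
theorem sum_hammingDist_cube (m : ℕ) :
    ∑ v : Fin m → Bool, ∑ w : Fin m → Bool, (hammingDist v w : ℝ) = (2 ^ m) ^ 2 * (m / 2) := by
  have hcompl : ∀ v w : Fin m → Bool, hammingDist v w + hammingDist v (fun i => !w i) = m := by
    intro v w
    rw [hammingDist, hammingDist]
    conv_rhs => rw [← Fintype.card_fin m, ← Finset.card_univ,
      ← Finset.card_filter_add_card_filter_not (fun i => v i ≠ w i)]
    congr 2
    ext i
    cases v i <;> cases w i <;> simp
  have hv : ∀ v : Fin m → Bool, ∑ w : Fin m → Bool, (hammingDist v w : ℝ) = 2 ^ m * (m / 2) := by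
    intro v
    have hinv : Function.Involutive fun w : Fin m → Bool => fun i => !w i := fun w => by simp
    have h1 := hinv.toPerm.sum_comp Finset.univ
      (fun w => (hammingDist v w : ℝ)) (by simp)
    have h2 : ∑ w : Fin m → Bool, ((hammingDist v w : ℝ) + hammingDist v (fun i => !w i)) =
        2 ^ m * m := by
      simp only [← Nat.cast_add, hcompl]
      simp
    rw [Finset.sum_add_distrib] at h2
    simp only [Function.Involutive.coe_toPerm] at h1
    linarith
  simp only [hv, Finset.sum_const, Finset.card_univ, nsmul_eq_mul]
  simp
  ring

/-- Since `d ≤ m` and `1/p ≤ 1`, `d^(1/p) ≥ m^(1/p-1) d`, so the mean Hamming distance settles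
exponent 1; Jensen gives exponent `s`. -/
theorem le_avg_norm_cubeVertex_sub {p s : ℝ} (hp : 1 ≤ p) (hs : 1 ≤ s) {m : ℕ} (hm : 0 < m) :
    (m : ℝ) ^ (1 / p) / 2 ≤ (1 / ((2 : ℝ) ^ m) ^ 2 * ∑ v : Fin m → Bool, ∑ w : Fin m → Bool,
      ‖cubeVertex p v - cubeVertex p w‖ ^ s) ^ (1 / s) := by
  have hp0 : 0 < p := by linarith
  have hs0 : 0 < s := by linarith
  have hm' : (0 : ℝ) < m := by exact_mod_cast hm
  have hnorm : ∀ v w : Fin m → Bool,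
      (m : ℝ) ^ (1 / p - 1) * hammingDist v w ≤ ‖cubeVertex p v - cubeVertex p w‖ := by
    intro v w
    rw [norm_cubeVertex_sub hp0]
    rcases Nat.eq_zero_or_pos (hammingDist v w) with h | h
    · rw [h]; simp [Real.zero_rpow (inv_ne_zero hp0.ne')]
    · have hd : (0 : ℝ) < hammingDist v w := by exact_mod_cast h
      have hdm : (hammingDist v w : ℝ) ≤ m := by
        have := hammingDist_le_card_fintype (x := v) (y := w)
        rw [Fintype.card_fin] at this
        exact_mod_cast this
      calc _ ≤ (hammingDist v w : ℝ) ^ (1 / p - 1) * hammingDist v w := by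
            refine mul_le_mul_of_nonneg_right ?_ hd.le
            exact Real.rpow_le_rpow_of_nonpos hd hdm
              (by rw [sub_nonpos, div_le_one hp0]; exact hp)
        _ = _ := by rw [← Real.rpow_add_one hd.ne', sub_add_cancel]
  have hmean : (m : ℝ) ^ (1 / p) / 2 ≤ 1 / ((2 : ℝ) ^ m) ^ 2 *
      ∑ v : Fin m → Bool, ∑ w : Fin m → Bool, ‖cubeVertex p v - cubeVertex p w‖ := by
    calc _ = 1 / ((2 : ℝ) ^ m) ^ 2 * ∑ v : Fin m → Bool, ∑ w : Fin m → Bool,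
          (m : ℝ) ^ (1 / p - 1) * hammingDist v w := by
          simp only [← Finset.mul_sum]
          rw [sum_hammingDist_cube, Real.rpow_sub_one hm'.ne']
          field_simp
      _ ≤ _ := by
          gcongr with v _ w _
          exact hnorm v w
  have hn : ∀ v w : Fin m → Bool, 0 ≤ ‖cubeVertex p v - cubeVertex p w‖ := fun v w =>
    lp.norm_nonneg' _
  refine hmean.trans ?_
  rw [one_div s, Real.le_rpow_inv_iff_of_pos
    (mul_nonneg (by positivity) (Finset.sum_nonneg fun v _ => Finset.sum_nonneg fun w _ => hn v w))
    (mul_nonneg (by positivity) (Finset.sum_nonneg fun v _ => Finset.sum_nonneg fun w _ =>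
      Real.rpow_nonneg (hn v w) s)) hs0]
  have hcard : (Fintype.card (Fin m → Bool) : ℝ) = 2 ^ m := by simp
  have h := Real.rpow_arith_mean_le_arith_mean_rpow
    (Finset.univ : Finset ((Fin m → Bool) × (Fin m → Bool)))
    (fun _ => 1 / ((2 : ℝ) ^ m) ^ 2) (fun z => ‖cubeVertex p z.1 - cubeVertex p z.2‖)
    (fun _ _ => by positivity)
    (by simp only [Finset.sum_const, Finset.card_univ, Fintype.card_prod, nsmul_eq_mul,
          Nat.cast_mul, hcard]; field_simp)
    (fun z _ => hn z.1 z.2) hs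
  simpa only [← Finset.mul_sum, Fintype.sum_prod_type] using h

/-! ### Comparison of the averages -/

theorem avgDist_comp_equiv (p s : ℝ) {m : ℕ} (e : (Fin m → Bool) ≃ Fin (2 ^ m))
    (x : Fin (2 ^ m) → Ell p) :
    avgDist p s x = (1 / ((2 : ℝ) ^ m) ^ 2 *
      ∑ v : Fin m → Bool, ∑ w : Fin m → Bool, ‖x (e v) - x (e w)‖ ^ s) ^ (1 / s) := by
  rw [avgDist, ← e.sum_comp]
  simp only [← e.sum_comp (fun j => ‖x (e _) - x j‖ ^ s)]
  push_cast
  rfl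

/-- Average-distance preserving maps from the Hamming cube in `ℓ_p` to `ℓ_q` stretch an edge. -/
theorem exists_cube_edge_stretched {p q r s : ℝ} (hp : 1 ≤ p) (hp2 : p < 2) (hpq : p < q)
    (hr : 1 ≤ r) (hs : 1 ≤ s) {m : ℕ} (hm : 0 < m) (e : (Fin m → Bool) ≃ Fin (2 ^ m))
    (y : Fin (2 ^ m) → Ell q)
    (hy : avgDist q r y = avgDist p s (fun i => cubeVertex p (e.symm i))) :
    ∃ i j : Fin (2 ^ m), ‖cubeVertex p (e.symm i) - cubeVertex p (e.symm j)‖ = 1 ∧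
      1 / 8 * (Real.log ((2 ^ m : ℕ) : ℝ) ^ (1 / p - 1 / min q 2) / √(q + r)) ≤
        ‖y i - y j‖ := by
  have hq : 1 ≤ q := hp.trans hpq.le
  have : Fact (1 ≤ ENNReal.ofReal q) := ⟨by simpa using ENNReal.ofReal_le_ofReal hq⟩
  have hm' : (0 : ℝ) < m := by exact_mod_cast hm
  have hexp : 0 < 1 / p - 1 / min q 2 :=
    sub_pos.2 (one_div_lt_one_div_of_lt (by linarith) (lt_min hpq hp2))
  -- If all edges were shorter than the bound, the factor `1/8` would make the average at most
  -- `m^(1/p)/4`, against the lower bound `m^(1/p)/2`.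
  by_contra! hcon
  set β := 1 / p - 1 / min q 2 with hβ
  have hlog : Real.log ((2 ^ m : ℕ) : ℝ) = m * Real.log 2 := by
    push_cast
    exact Real.log_pow 2 m
  have hlog0 : 0 ≤ Real.log ((2 ^ m : ℕ) : ℝ) := Real.log_natCast_nonneg _
  have hlogm : Real.log ((2 ^ m : ℕ) : ℝ) ≤ m := by
    rw [hlog]
    exact mul_le_of_le_one_right hm'.le (Real.log_two_lt_d9.le.trans (by norm_num))
  have hsq : 0 < √(q + r) := Real.sqrt_pos.2 (by linarith)
  set L := 1 / 8 * (Real.log ((2 ^ m : ℕ) : ℝ) ^ β / √(q + r)) with hL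
  have hL0 : 0 ≤ L := by positivity
  have hup := Ell.cube_average_le hq hr hL0 m (fun v => y (e v)) (fun v i => by
    refine (hcon (e v) (e (Function.update v i (!v i))) ?_).le
    rw [e.symm_apply_apply, e.symm_apply_apply, norm_cubeVertex_sub (by linarith)]
    have : hammingDist v (Function.update v i (!v i)) = 1 := by
      rw [hammingDist, Finset.card_eq_one]
      refine ⟨i, ?_⟩
      ext j
      by_cases h : j = i
      · subst h; simp
      · simp [h]
    rw [this, Nat.cast_one, Real.one_rpow])
  have hlow := le_avg_norm_cubeVertex_sub hp hs hm
  rw [avgDist_comp_equiv q r e, avgDist_comp_equiv p s e] at hy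
  simp only [e.symm_apply_apply] at hy
  rw [hy] at hup
  have hpow : Real.log ((2 ^ m : ℕ) : ℝ) ^ β ≤ (m : ℝ) ^ β :=
    Real.rpow_le_rpow hlog0 hlogm hexp.le
  have hfin : 2 * √(q + r) * (m : ℝ) ^ (1 / min q 2) * L ≤ (m : ℝ) ^ (1 / p) / 4 := by
    calc _ = (m : ℝ) ^ (1 / min q 2) * Real.log ((2 ^ m : ℕ) : ℝ) ^ β / 4 := by
          rw [hL]; field_simp; norm_num
      _ ≤ (m : ℝ) ^ (1 / min q 2) * (m : ℝ) ^ β / 4 := by gcongr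
      _ = _ := by rw [← Real.rpow_add hm', hβ, add_sub_cancel]
  have : 0 < (m : ℝ) ^ (1 / p) := by positivity
  linarith [hlow.trans (hup.trans hfin)]

theorem exists_cube_average_distortion {p q r s : ℝ} (hp : 1 ≤ p) (hp2 : p < 2) (hpq : p < q)
    (hr : 1 ≤ r) (hs : 1 ≤ s) (N : ℕ) :
    ∃ n : ℕ, N ≤ n ∧ ∃ x : Fin n → Ell p,
      (∃ m : ℕ, n = 2 ^ m ∧ Function.Injective x ∧ Set.range x = hammingCube p m) ∧
      ∀ y : Fin n → Ell q, avgDist q r y = avgDist p s x →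
        ∃ i j : Fin n,
          1 / 8 * (Real.log (n : ℝ) ^ (1 / p - 1 / min q 2) / Real.sqrt (q + r) * ‖x i - x j‖)
            ≤ ‖y i - y j‖ ∧
          0 < Real.log (n : ℝ) ^ (1 / p - 1 / min q 2) / Real.sqrt (q + r) * ‖x i - x j‖ := by
  -- Dimension `N + 1` rather than `N` keeps `log n` positive when `N = 0`.
  have e : (Fin (N + 1) → Bool) ≃ Fin (2 ^ (N + 1)) := Fintype.equivFinOfCardEq (by simp)
  refine ⟨2 ^ (N + 1), (Nat.lt_two_pow_self.le.trans
    (Nat.pow_le_pow_right two_pos N.le_succ)), fun i => cubeVertex p (e.symm i),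
    ⟨N + 1, rfl, (cubeVertex_injective p _).comp e.symm.injective, ?_⟩, fun y hy => ?_⟩
  · rw [← range_cubeVertex]
    exact e.symm.surjective.range_comp (cubeVertex p)
  · obtain ⟨i, j, hx, hij⟩ :=
      exists_cube_edge_stretched hp hp2 hpq hr hs N.succ_pos e y hy
    have hlog : 0 < Real.log ((2 ^ (N + 1) : ℕ) : ℝ) :=
      Real.log_pos (by exact_mod_cast Nat.one_lt_two_pow N.succ_ne_zero)
    have hsq : 0 < √(q + r) := Real.sqrt_pos.2 (by linarith)
    refine ⟨i, j, ?_, ?_⟩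
    · rw [hx, mul_one]
      exact hij
    · rw [hx, mul_one]
      positivity

theorem not_exists_average_embedding_constant {p : ℝ} (hp : 1 ≤ p) (hp2 : p < 2) :
    ¬ ∃ K : ℝ, ∀ (n : ℕ) (x : Fin n → Ell p), ∃ y : Fin n → Ell 2,
      (∀ i j : Fin n, ‖y i - y j‖ ≤ K * ‖x i - x j‖) ∧
      ∑ i, ∑ j, ‖y i - y j‖ ^ 2 = ∑ i, ∑ j, ‖x i - x j‖ ^ 2 := by
  rintro ⟨K, hK⟩
  have hexp : 0 < 1 / p - 1 / min (2 : ℝ) 2 := by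
    rw [min_self]
    exact sub_pos.2 (one_div_lt_one_div_of_lt (by linarith) hp2)
  have hsq : 0 < √((2 : ℝ) + 2) := Real.sqrt_pos.2 (by norm_num)
  have htend : Filter.Tendsto (fun n : ℕ => 1 / 8 *
      (Real.log (n : ℝ) ^ (1 / p - 1 / min (2 : ℝ) 2) / √((2 : ℝ) + 2)))
      Filter.atTop Filter.atTop :=
    (((tendsto_rpow_atTop hexp).comp (Real.tendsto_log_atTop.comp
      tendsto_natCast_atTop_atTop)).atTop_div_const hsq).const_mul_atTop (by norm_num)
  obtain ⟨N, hN⟩ := Filter.eventually_atTop.1 (htend.eventually_gt_atTop K)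
  -- At `q = r = s = 2` the stretching factor tends to infinity with `n`, so it exceeds `K` from `N`
  -- on.
  obtain ⟨n, hn, x, -, hx⟩ := exists_cube_average_distortion hp hp2 hp2 one_le_two one_le_two N
  obtain ⟨y, hy, hsum⟩ := hK n x
  obtain ⟨i, j, hij, hpos⟩ := hx y (by
    rw [avgDist, avgDist]
    simp only [Real.rpow_two]
    rw [hsum])
  have hx0 : 0 < ‖x i - x j‖ :=
    (lp.norm_nonneg' _).lt_of_ne fun h => by rw [← h, mul_zero] at hpos; exact hpos.false
  have h := hij.trans (hy i j)
  rw [← mul_assoc] at h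
  exact (hN n hn).not_ge (le_of_mul_le_mul_right h hx0)

theorem lemma1p10 :
    (∃ c : ℝ, 0 < c ∧
      ∀ p q r s : ℝ, 1 ≤ p → p < 2 → p < q → 1 ≤ r → 1 ≤ s →
        ∀ N : ℕ, ∃ n : ℕ, N ≤ n ∧ ∃ x : Fin n → Ell p,
          (∃ m : ℕ, n = 2 ^ m ∧ Function.Injective x ∧ Set.range x = hammingCube p m) ∧
          ∀ y : Fin n → Ell q, avgDist q r y = avgDist p s x →
            ∃ i j : Fin n,
              c * (Real.log (n : ℝ) ^ (1 / p - 1 / min q 2) / Real.sqrt (q + r) * ‖x i - x j‖)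
                ≤ ‖y i - y j‖ ∧
              0 < Real.log (n : ℝ) ^ (1 / p - 1 / min q 2) / Real.sqrt (q + r) * ‖x i - x j‖) ∧
    (∀ p : ℝ, 1 ≤ p → p < 2 →
      ¬ ∃ K : ℝ, ∀ (n : ℕ) (x : Fin n → Ell p), ∃ y : Fin n → Ell 2,
          (∀ i j : Fin n, ‖y i - y j‖ ≤ K * ‖x i - x j‖) ∧
          ∑ i, ∑ j, ‖y i - y j‖ ^ 2 = ∑ i, ∑ j, ‖x i - x j‖ ^ 2) := by

  exact ⟨⟨1 / 8, by norm_num, fun p q r s hp hp2 hpq hr hs N =>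
    exists_cube_average_distortion hp hp2 hpq hr hs N⟩,
    fun p hp hp2 => not_exists_average_embedding_constant hp hp2⟩
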